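/- Let $f:\mathbb{R}^n\to\mathbb{R}^n$ be $C^3$ with $f(x^*)=0$. Put $N=\operatorname{null} f'(x^*)$ and $R=\operatorname{range} f'(x^*)$, assume $\dim N=1$ and $R\perp N$, and let $P_N,P_R$ be the orthogonal projections onto $N$ and $R$. Let $0\neq\varphi\in N$ and assume that $\hat D(\cdot)=P_Nf''(x^*)(\varphi,P_N\,\cdot)$ is invertible as a map $N\to N$. Fix $\hat r\in(0,1)$. For a starting point $x_0$, the adaptive $\gamma$-safeguarded Newton–Anderson iteration is as follows: $w_{k+1}=-f'(x_k)^{-1}f(x_k)$ for $k\ge 0$, $x_1=x_0+w_1$, and for $k\ge1$ $$x_{k+1}=x_k+w_{k+1}-\lambda_{k+1}\gamma_{k+1}(x_k-x_{k-1}+w_{k+1}-w_k),\qquad \gamma_{k+1}=\frac{(w_{k+1}-w_k)^Tw_{k+1}}{\|w_{k+1}-w_k\|^2},$$ where, with $\eta_{k+1}=\|w_{k+1}\|/\|w_k\|$ and $\beta_{k+1}=\min\{\eta_{k+1},\hat r\}\,\eta_{k+1}$: $\lambda_{k+1}=0$ if $\gamma_{k+1}=0$ or $\gamma_{k+1}\ge1$;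 otherwise $\lambda_{k+1}=\dfrac{\beta_{k+1}}{\gamma_{k+1}(\beta_{k+1}+\operatorname{sign}\gamma_{k+1})}$ if $|\gamma_{k+1}|/|1-\gamma_{k+1}|>\beta_{k+1}$; and $\lambda_{k+1}=1$ in all other cases. Norms are Euclidean. Put $e_k=x_k-x^*$, $\sigma_k=\|P_Re_k\|/\|P_Ne_k\|$, $\theta^\lambda_{k+1}=\|w_{k+1}-\lambda_{k+1}\gamma_{k+1}(w_{k+1}-w_k)\|/\|w_{k+1}\|$, and for $\rho,s\geq 0$ $$W(\rho,s)=B_\rho(x^*)\cap\{x:\|P_R(x-x^*)\|<s\|P_N(x-x^*)\|\},\qquad W_k=W(\|e_k\|,\sigma_k),$$ with $B_\rho(x^*)$ the open ball. Then there are constants $\hat\sigma,\hat\rho,C,c>0$ and $\kappa\in(1/2,1)$ such that $f'(x)$ is invertible for all $x\in\hat W:=W(\hat\rho,\hat\sigma)$ and, for every $x_0$ with $P_Ne_0\ne0$, $\sigma_0<\hat\sigma$ and $\|e_0\|<\hat\rho$: 1. the iteration is well defined: for all $k\ge0$, $x_k\in\hat W$, $f'(x_k)$ is invertible, $P_Ne_k\neq0$,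 $w_{k+1}\ne0$ and $w_{k+2}\neq w_{k+1}$; 2. $W_{k+1}\subset W(\|e_0\|,\hat\sigma)\subset\hat W$ for all $k\ge0$; and if $\|e_0\|\le c\,\sigma_0$ (that is, $\|e_0\|$ is small relative to $\sigma_0$), then $W_{k+1}\subset W_0$ for all $k\geq0$; 3. $x_k\to x^*$; 4. for all $k\ge1$, $$\|P_Re_{k+1}\|\le C\max\{|1-\lambda_{k+1}\gamma_{k+1}|\,\|e_k\|^2,\ |\lambda_{k+1}\gamma_{k+1}|\,\|e_{k-1}\|^2\},\qquad \|P_Ne_{k+1}\|\le\kappa\,\theta^\lambda_{k+1}\,\|P_Ne_k\|.$$ -/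

import Mathlib

open Filter Topology

noncomputable section

namespace NewtonAnderson

variable {n : ℕ}

/-- The null space `N` of the derivative `f'(xs)`. -/
abbrev nullSp (f : EuclideanSpace ℝ (Fin n) → EuclideanSpace ℝ (Fin n))
    (xs : EuclideanSpace ℝ (Fin n)) : Submodule ℝ (EuclideanSpace ℝ (Fin n)) :=
  LinearMap.ker (fderiv ℝ f xs).toLinearMap

/-- The range `R` of the derivative `f'(xs)`. -/
abbrev rangeSp (f : EuclideanSpace ℝ (Fin n) → EuclideanSpace ℝ (Fin n))
    (xs : EuclideanSpace ℝ (Fin n)) : Submodule ℝ (EuclideanSpace ℝ (Fin n)) :=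
  LinearMap.range (fderiv ℝ f xs).toLinearMap

/-- The orthogonal projection `P_N`, as an operator on the whole space. -/
def projN (f : EuclideanSpace ℝ (Fin n) → EuclideanSpace ℝ (Fin n))
    (xs : EuclideanSpace ℝ (Fin n)) :
    EuclideanSpace ℝ (Fin n) →L[ℝ] EuclideanSpace ℝ (Fin n) :=
  (nullSp f xs).starProjection

/-- The orthogonal projection `P_R`, as an operator on the whole space. -/
def projR (f : EuclideanSpace ℝ (Fin n) → EuclideanSpace ℝ (Fin n))
    (xs : EuclideanSpace ℝ (Fin n)) :
    EuclideanSpace ℝ (Fin n) →L[ℝ] EuclideanSpace ℝ (Fin n) :=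
  (rangeSp f xs).starProjection

/-- The operator `D̂ = P_N f''(xs)(φ, P_N ·)` as a map from `N` to `N`
(on `N` the inner `P_N` is the identity). -/
def Dhat (f : EuclideanSpace ℝ (Fin n) → EuclideanSpace ℝ (Fin n))
    (xs φ : EuclideanSpace ℝ (Fin n)) : nullSp f xs →L[ℝ] nullSp f xs :=
  (nullSp f xs).orthogonalProjectionOnto ∘L
    (fderiv ℝ (fderiv ℝ f) xs φ) ∘L (nullSp f xs).subtypeL

/-- The Newton update `-f'(x)⁻¹ f(x)`; it is meaningful when `f'(x)` is invertible. -/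
def newtonUpdate (f : EuclideanSpace ℝ (Fin n) → EuclideanSpace ℝ (Fin n))
    (x : EuclideanSpace ℝ (Fin n)) : EuclideanSpace ℝ (Fin n) :=
  -((fderiv ℝ f x).inverse (f x))

/-- The Anderson coefficient `γ` of two successive updates `w` (older) and `w'` (newer);
it is meaningful when `w' ≠ w`. -/
def anderson (w w' : EuclideanSpace ℝ (Fin n)) : ℝ :=
  inner ℝ (w' - w) w' / ‖w' - w‖ ^ 2

/-- `β = r η` with `η = ‖w'‖ / ‖w‖` and `r = min {η, rhat}`. -/
def safeguardTol (rhat : ℝ) (w w' : EuclideanSpace ℝ (Fin n)) : ℝ :=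
  min (‖w'‖ / ‖w‖) rhat * (‖w'‖ / ‖w‖)

open Classical in
/-- The factor `λ` computed by adaptive `γ`-safeguarding. -/
def safeguardFactor (rhat : ℝ) (w w' : EuclideanSpace ℝ (Fin n)) : ℝ :=
  if anderson w w' = 0 ∨ 1 ≤ anderson w w' then 0
  else if safeguardTol rhat w w' < |anderson w w'| / |1 - anderson w w'| then
    safeguardTol rhat w w' /
      (anderson w w' * (safeguardTol rhat w w' + Real.sign (anderson w w')))
  else 1

/-- The safeguarded coefficient `λ γ`, for the successive iterates `xp` (older) and `x` (newer). -/
def lamGamma (f : EuclideanSpace ℝ (Fin n) → EuclideanSpace ℝ (Fin n)) (rhat : ℝ)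
    (xp x : EuclideanSpace ℝ (Fin n)) : ℝ :=
  safeguardFactor rhat (newtonUpdate f xp) (newtonUpdate f x) *
    anderson (newtonUpdate f xp) (newtonUpdate f x)

/-- The gain `θ^λ = ‖w' - λ γ (w' - w)‖ / ‖w'‖`, for the successive iterates `xp` and `x`. -/
def gain (f : EuclideanSpace ℝ (Fin n) → EuclideanSpace ℝ (Fin n)) (rhat : ℝ)
    (xp x : EuclideanSpace ℝ (Fin n)) : ℝ :=
  ‖newtonUpdate f x - lamGamma f rhat xp x • (newtonUpdate f x - newtonUpdate f xp)‖ /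
    ‖newtonUpdate f x‖

/-- The iterates `x_k` of adaptive `γ`-safeguarded Newton–Anderson, started at `x0`. -/
def iter (f : EuclideanSpace ℝ (Fin n) → EuclideanSpace ℝ (Fin n)) (rhat : ℝ)
    (x0 : EuclideanSpace ℝ (Fin n)) : ℕ → EuclideanSpace ℝ (Fin n)
  | 0 => x0
  | 1 => x0 + newtonUpdate f x0
  | k + 2 =>
      iter f rhat x0 (k + 1) + newtonUpdate f (iter f rhat x0 (k + 1))
        - lamGamma f rhat (iter f rhat x0 k) (iter f rhat x0 (k + 1)) •
          (iter f rhat x0 (k + 1) - iter f rhat x0 k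
            + newtonUpdate f (iter f rhat x0 (k + 1)) - newtonUpdate f (iter f rhat x0 k))

/-- `σ(x) = ‖P_R (x - xs)‖ / ‖P_N (x - xs)‖`; it is meaningful when `P_N (x - xs) ≠ 0`. -/
def sigma (f : EuclideanSpace ℝ (Fin n) → EuclideanSpace ℝ (Fin n))
    (xs x : EuclideanSpace ℝ (Fin n)) : ℝ :=
  ‖projR f xs (x - xs)‖ / ‖projN f xs (x - xs)‖

/-- `B_ρ(xs) ∩ {x : ‖P_R (x - xs)‖ < s ‖P_N (x - xs)‖}`. -/
def region (f : EuclideanSpace ℝ (Fin n) → EuclideanSpace ℝ (Fin n))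
    (xs : EuclideanSpace ℝ (Fin n)) (ρ s : ℝ) : Set (EuclideanSpace ℝ (Fin n)) :=
  Metric.ball xs ρ ∩ {x | ‖projR f xs (x - xs)‖ < s * ‖projN f xs (x - xs)‖}

/-- `W(x) = B_{‖x - xs‖}(xs) ∩ {y : ‖P_R (y - xs)‖ < σ(x) ‖P_N (y - xs)‖}`,
so that `W_k = W(x_k)`. -/
def regionAt (f : EuclideanSpace ℝ (Fin n) → EuclideanSpace ℝ (Fin n))
    (xs x : EuclideanSpace ℝ (Fin n)) : Set (EuclideanSpace ℝ (Fin n)) :=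
  region f xs ‖x - xs‖ (sigma f xs x)

end NewtonAnderson

end

/-!
Write `e = x - x*` and let `P`, `Q` be the orthogonal projections onto `N` and `Nᗮ = R`. As `x → x*`
within cones `‖Q e‖ = o(‖P e‖)`, the derivative `f'(x)` is a singular perturbation of `f'(x*)`: its
`N`-block has size `‖P e‖`, because `D̂` is invertible, and the block on `R` stays bounded below.
Together with the trapezoidal expansion `f(x) ≈ (f'(x) + f'(x*)) e / 2` this shows that the Newton
update is `w = -P e / 2 + o(‖P e‖)`, while `Q (e + w) = O(‖e‖²)`.

The new error is the mixture `(1 - μ) (e' + w') + μ (e + w)` of two Newton steps, with `μ = λ γ`.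
The safeguard ensures `|μ| ‖w‖ ≤ r |1 - μ| ‖w'‖` with `r < 1`, so the `N`-components of the two
terms cannot cancel: the mixture keeps an `N`-component comparable with `|1 - μ| ‖P e'‖`, which
dominates its quadratically small `R`-component, and the iteration does not leave the cone.
-/

open Asymptotics

namespace NewtonAnderson

section Taylor

variable {E F : Type*} [NormedAddCommGroup E] [NormedSpace ℝ E]
  [NormedAddCommGroup F] [NormedSpace ℝ F] {f : E → F} {xs : E}

theorem norm_taylor_two_le {δ r : ℝ}
    (hf : ∀ y ∈ Metric.ball xs r, DifferentiableAt ℝ f y)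
    (hf' : ∀ y ∈ Metric.ball xs r,
      ‖fderiv ℝ f y - fderiv ℝ f xs - fderiv ℝ (fderiv ℝ f) xs (y - xs)‖ ≤ δ * ‖y - xs‖)
    {x : E} (hx : x ∈ Metric.ball xs r) (hδ : 0 ≤ δ) :
    ‖f x - f xs - fderiv ℝ f xs (x - xs)
      - (1 / 2 : ℝ) • fderiv ℝ (fderiv ℝ f) xs (x - xs) (x - xs)‖ ≤ δ * ‖x - xs‖ ^ 2 := by
  set A := fderiv ℝ f xs
  set B := fderiv ℝ (fderiv ℝ f) xs
  set e := x - xs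
  have hseg : ∀ s ∈ Set.Icc (0 : ℝ) 1, xs + s • e ∈ Metric.ball xs r := fun s hs =>
    (convex_ball xs r).add_smul_sub_mem
      (Metric.mem_ball_self (dist_nonneg.trans_lt (Metric.mem_ball.1 hx))) hx hs
  have hderiv : ∀ s ∈ Set.Icc (0 : ℝ) 1,
      HasDerivWithinAt (fun s : ℝ => f (xs + s • e) - s • A e - (s ^ 2 / 2) • B e e)
        ((fderiv ℝ f (xs + s • e) - A - B (s • e)) e) (Set.Icc 0 1) s := fun s hs => by
    have hline : HasDerivAt (fun s : ℝ => xs + s • e) e s := by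
      simpa using ((hasDerivAt_id s).smul_const e).const_add xs
    have hsq : HasDerivAt (fun s : ℝ => s ^ 2 / 2) s s := by
      simpa using (hasDerivAt_pow 2 s).div_const 2
    have h := (((hf _ (hseg s hs)).hasFDerivAt.comp_hasDerivAt s hline).sub
      ((hasDerivAt_id s).smul_const (A e))).sub (hsq.smul_const (B e e))
    exact (h.congr_deriv (by simp)).hasDerivWithinAt
  have hbound : ∀ s ∈ Set.Ico (0 : ℝ) 1,
      ‖(fderiv ℝ f (xs + s • e) - A - B (s • e)) e‖ ≤ δ * ‖e‖ ^ 2 := fun s hs => by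
    have h := hf' _ (hseg s ⟨hs.1, hs.2.le⟩)
    rw [add_sub_cancel_left, norm_smul, Real.norm_of_nonneg hs.1] at h
    calc ‖(fderiv ℝ f (xs + s • e) - A - B (s • e)) e‖ ≤ δ * (s * ‖e‖) * ‖e‖ :=
          ContinuousLinearMap.le_of_opNorm_le _ h e
      _ ≤ δ * (1 * ‖e‖) * ‖e‖ := by gcongr; exact hs.2.le
      _ = δ * ‖e‖ ^ 2 := by ring
  simpa [e, sub_right_comm] using norm_image_sub_le_of_norm_deriv_le_segment_01' hderiv hbound

theorem taylor_two_isLittleO (hf : ∀ᶠ x in 𝓝 xs, DifferentiableAt ℝ f x)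
    (hf' : DifferentiableAt ℝ (fderiv ℝ f) xs) :
    (fun x => f x - f xs - fderiv ℝ f xs (x - xs)
      - (1 / 2 : ℝ) • fderiv ℝ (fderiv ℝ f) xs (x - xs) (x - xs))
      =o[𝓝 xs] fun x => ‖x - xs‖ ^ 2 := by
  refine isLittleO_iff.2 fun δ hδ => ?_
  obtain ⟨r, hr, hball⟩ := Metric.eventually_nhds_iff_ball.1
    (hf.and (isLittleO_iff.1 (hasFDerivAt_iff_isLittleO.1 hf'.hasFDerivAt) hδ))
  filter_upwards [Metric.ball_mem_nhds xs hr] with x hx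
  simpa using norm_taylor_two_le (fun y hy => (hball y hy).1) (fun y hy => (hball y hy).2) hx hδ.le

theorem trapezoid_sub_isLittleO (hf : ∀ᶠ x in 𝓝 xs, DifferentiableAt ℝ f x)
    (hf' : DifferentiableAt ℝ (fderiv ℝ f) xs) :
    (fun x => f x - f xs - (1 / 2 : ℝ) • (fderiv ℝ f x (x - xs) + fderiv ℝ f xs (x - xs)))
      =o[𝓝 xs] fun x => ‖x - xs‖ ^ 2 := by
  have hderiv : (fun x => (fderiv ℝ f x - fderiv ℝ f xs
      - fderiv ℝ (fderiv ℝ f) xs (x - xs)) (x - xs)) =o[𝓝 xs] fun x => ‖x - xs‖ ^ 2 := by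
    have h := (hasFDerivAt_iff_isLittleO.1 hf'.hasFDerivAt).norm_norm.mul_isBigO
      (isBigO_refl (fun x => ‖x - xs‖) (𝓝 xs))
    simp only [← sq] at h
    refine (isBigO_of_le _ fun x => ?_).trans_isLittleO h
    simpa using ContinuousLinearMap.le_opNorm
      (fderiv ℝ f x - fderiv ℝ f xs - fderiv ℝ (fderiv ℝ f) xs (x - xs)) (x - xs)
  refine ((taylor_two_isLittleO hf hf').sub (hderiv.const_smul_left (1 / 2 : ℝ))).congr_left
    fun x => ?_
  simp only [Pi.smul_apply, sub_apply]
  module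

end Taylor

section SingularPerturbation

variable {E : Type*} [NormedAddCommGroup E] [InnerProductSpace ℝ E]
  {N : Submodule ℝ E} [N.HasOrthogonalProjection] {A L : E →L[ℝ] E} {m τ a : ℝ}

theorem norm_le_add_norm_starProjection_orthogonal (v : E) :
    ‖v‖ ≤ ‖N.starProjection v‖ + ‖Nᗮ.starProjection v‖ := by
  conv_lhs => rw [← N.starProjection_add_starProjection_orthogonal v]
  exact norm_add_le _ _

theorem starProjection_starProjection (v : E) :
    N.starProjection (N.starProjection v) = N.starProjection v :=
  Submodule.starProjection_eq_self_iff.2 (N.starProjection_apply_mem v)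

/-- `L` is a perturbation of size `τ` of an operator `A` with range in `Nᗮ` that is bounded below
by `m` on `Nᗮ`, and the block of `L` that maps `N` to `N` is bounded below by `a`. The last two
conditions keep the block elimination of `L v = y` along `N ⊕ Nᗮ` stable. -/
structure IsSingularPerturbation (N : Submodule ℝ E) [N.HasOrthogonalProjection]
    (A L : E →L[ℝ] E) (m τ a : ℝ) : Prop where
  apply_mem (v : E) : A v ∈ Nᗮ
  mul_norm_le_apply (v : E) : m * ‖Nᗮ.starProjection v‖ ≤ ‖A v‖
  opNorm_sub_le : ‖L - A‖ ≤ τ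
  mul_norm_le_block (v : E) : v ∈ N → a * ‖v‖ ≤ ‖N.starProjection (L v)‖
  m_pos : 0 < m
  a_pos : 0 < a
  two_mul_le : 2 * τ ≤ m
  sq_le : 4 * τ ^ 2 ≤ a * m

namespace IsSingularPerturbation

variable (h : IsSingularPerturbation N A L m τ a)
include h

theorem norm_sub_apply_le (v : E) : ‖L v - A v‖ ≤ τ * ‖v‖ :=
  (L - A).le_of_opNorm_le h.opNorm_sub_le v

theorem nonneg : 0 ≤ τ := (norm_nonneg _).trans h.opNorm_sub_le

theorem starProjection_apply (v : E) : N.starProjection (A v) = 0 :=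
  N.starProjection_apply_eq_zero_iff.2 (h.apply_mem v)

theorem half_mul_norm_orthogonal_le (v : E) :
    m / 2 * ‖Nᗮ.starProjection v‖ ≤ ‖Nᗮ.starProjection (L v)‖ + τ * ‖N.starProjection v‖ := by
  have hA : A v = Nᗮ.starProjection (L v) - Nᗮ.starProjection (L v - A v) := by
    rw [map_sub, sub_sub_cancel, Submodule.starProjection_eq_self_iff.2 (h.apply_mem v)]
  have hτ : τ * ‖Nᗮ.starProjection v‖ ≤ m / 2 * ‖Nᗮ.starProjection v‖ := by
    gcongr; linarith [h.two_mul_le]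
  have hsplit : τ * ‖v‖ ≤ τ * ‖N.starProjection v‖ + τ * ‖Nᗮ.starProjection v‖ := by
    rw [← mul_add]
    exact mul_le_mul_of_nonneg_left (norm_le_add_norm_starProjection_orthogonal v) h.nonneg
  have := calc m * ‖Nᗮ.starProjection v‖ ≤ ‖A v‖ := h.mul_norm_le_apply v
    _ ≤ ‖Nᗮ.starProjection (L v)‖ + ‖Nᗮ.starProjection (L v - A v)‖ :=
      (congrArg norm hA).trans_le (norm_sub_le _ _)
    _ ≤ ‖Nᗮ.starProjection (L v)‖ + τ * ‖v‖ := by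
      gcongr
      exact (Nᗮ.norm_starProjection_apply_le _).trans (h.norm_sub_apply_le v)
  linarith

theorem half_mul_norm_le (v : E) :
    a / 2 * ‖N.starProjection v‖ ≤
      ‖N.starProjection (L v)‖ + 2 * τ / m * ‖Nᗮ.starProjection (L v)‖ := by
  have hm := h.m_pos
  have hτ := h.nonneg
  have hcross : ‖N.starProjection (L (Nᗮ.starProjection v))‖ ≤ τ * ‖Nᗮ.starProjection v‖ := by
    have h0 : N.starProjection (L (Nᗮ.starProjection v)) =
        N.starProjection (L (Nᗮ.starProjection v) - A (Nᗮ.starProjection v)) := by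
      rw [map_sub, h.starProjection_apply, sub_zero]
    rw [h0]
    exact (N.norm_starProjection_apply_le _).trans (h.norm_sub_apply_le _)
  have hblock : a * ‖N.starProjection v‖ ≤
      ‖N.starProjection (L v)‖ + τ * ‖Nᗮ.starProjection v‖ := by
    have hv : L (N.starProjection v) = L v - L (Nᗮ.starProjection v) := by
      rw [← map_sub, N.starProjection_orthogonal_val, sub_sub_cancel]
    calc a * ‖N.starProjection v‖ ≤ ‖N.starProjection (L (N.starProjection v))‖ :=
          h.mul_norm_le_block _ (N.starProjection_apply_mem v)
      _ ≤ ‖N.starProjection (L v)‖ + ‖N.starProjection (L (Nᗮ.starProjection v))‖ := by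
          rw [hv, map_sub]; exact norm_sub_le _ _
      _ ≤ ‖N.starProjection (L v)‖ + τ * ‖Nᗮ.starProjection v‖ := by gcongr
  have hsubst : τ * ‖Nᗮ.starProjection v‖ ≤
      2 * τ / m * ‖Nᗮ.starProjection (L v)‖ + 2 * τ ^ 2 / m * ‖N.starProjection v‖ := by
    have := mul_le_mul_of_nonneg_left (h.half_mul_norm_orthogonal_le v)
      (by positivity : 0 ≤ 2 * τ / m)
    field_simp at this ⊢
    linarith
  have hschur : 2 * τ ^ 2 / m * ‖N.starProjection v‖ ≤ a / 2 * ‖N.starProjection v‖ := by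
    refine mul_le_mul_of_nonneg_right ?_ (norm_nonneg _)
    rw [div_le_iff₀ hm]
    linarith [h.sq_le]
  linarith

protected theorem injective : Function.Injective L := by
  refine (injective_iff_map_eq_zero L).2 fun v hv => ?_
  have hP := h.half_mul_norm_le v
  have hQ := h.half_mul_norm_orthogonal_le v
  simp only [hv, map_zero, norm_zero, mul_zero, add_zero, zero_add] at hP hQ
  have hP0 : ‖N.starProjection v‖ = 0 :=
    (nonpos_of_mul_nonpos_right hP (half_pos h.a_pos)).antisymm (norm_nonneg _)
  rw [hP0, mul_zero] at hQ
  have hQ0 : ‖Nᗮ.starProjection v‖ ≤ 0 :=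
    nonpos_of_mul_nonpos_right hQ (half_pos h.m_pos)
  exact norm_le_zero_iff.1
    ((norm_le_add_norm_starProjection_orthogonal (N := N) v).trans (by linarith))

variable {e y w : E}

theorem newton_error_le (hw : L w = -y) :
    a / 2 * ‖N.starProjection (w + (1 / 2 : ℝ) • e)‖ ≤
      2 * ‖y - (1 / 2 : ℝ) • (L e + A e)‖ + τ / m * ‖A e‖ := by
  have hτm : τ / m ≤ 1 / 2 := by rw [div_le_iff₀ h.m_pos]; linarith [h.two_mul_le]
  have hτm0 : 0 ≤ τ / m := div_nonneg h.nonneg h.m_pos.le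
  have hL : L (w + (1 / 2 : ℝ) • e) = -(y - (1 / 2 : ℝ) • (L e + A e)) - (1 / 2 : ℝ) • A e := by
    rw [map_add, map_smul, hw]
    module
  set g := y - (1 / 2 : ℝ) • (L e + A e)
  have hP : ‖N.starProjection (L (w + (1 / 2 : ℝ) • e))‖ ≤ ‖g‖ := by
    rw [hL, map_sub, map_smul, h.starProjection_apply, smul_zero, sub_zero, map_neg, norm_neg]
    exact N.norm_starProjection_apply_le g
  have hQ : ‖Nᗮ.starProjection (L (w + (1 / 2 : ℝ) • e))‖ ≤ ‖g‖ + 1 / 2 * ‖A e‖ := by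
    refine (Nᗮ.norm_starProjection_apply_le _).trans ?_
    rw [hL]
    refine (norm_sub_le _ _).trans_eq ?_
    rw [norm_neg, norm_smul, Real.norm_of_nonneg one_half_pos.le]
  calc a / 2 * ‖N.starProjection (w + (1 / 2 : ℝ) • e)‖
      ≤ ‖N.starProjection (L (w + (1 / 2 : ℝ) • e))‖ +
          2 * τ / m * ‖Nᗮ.starProjection (L (w + (1 / 2 : ℝ) • e))‖ := h.half_mul_norm_le _
    _ = ‖N.starProjection (L (w + (1 / 2 : ℝ) • e))‖ +
          2 * (τ / m) * ‖Nᗮ.starProjection (L (w + (1 / 2 : ℝ) • e))‖ := by rw [mul_div_assoc]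
    _ ≤ ‖g‖ + 2 * (τ / m) * (‖g‖ + 1 / 2 * ‖A e‖) := by gcongr
    _ = ‖g‖ + 2 * (τ / m) * ‖g‖ + τ / m * ‖A e‖ := by ring
    _ ≤ ‖g‖ + 2 * (1 / 2) * ‖g‖ + τ / m * ‖A e‖ := by gcongr
    _ = 2 * ‖g‖ + τ / m * ‖A e‖ := by ring

theorem newton_error_orthogonal_le (hw : L w = -y) :
    m / 2 * ‖Nᗮ.starProjection (e + w)‖ ≤
      ‖y - (1 / 2 : ℝ) • (L e + A e)‖ + 1 / 2 * (τ * ‖e‖) + τ * ‖N.starProjection (e + w)‖ := by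
  have hL : L (e + w) = -(y - (1 / 2 : ℝ) • (L e + A e)) + (1 / 2 : ℝ) • (L e - A e) := by
    rw [map_add, hw]
    module
  refine (h.half_mul_norm_orthogonal_le (e + w)).trans (add_le_add_left ?_ _)
  refine (Nᗮ.norm_starProjection_apply_le _).trans ?_
  rw [hL]
  refine (norm_add_le _ _).trans ?_
  rw [norm_neg, norm_smul, Real.norm_of_nonneg one_half_pos.le]
  gcongr
  exact h.norm_sub_apply_le e

end IsSingularPerturbation

end SingularPerturbation

section Cone

variable {E : Type*} [NormedAddCommGroup E] [InnerProductSpace ℝ E]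
  (N : Submodule ℝ E) [N.HasOrthogonalProjection] (xs : E)

/-- The filter of the approach `x → xs` along `N`: the component of `x - xs` in `N` does not vanish
and dominates the orthogonal one, whose relative size tends to zero. -/
def conicNhds : Filter E :=
  ⨅ t ∈ Set.Ioi (0 : ℝ), 𝓟 {x | ‖x - xs‖ < t ∧
    ‖Nᗮ.starProjection (x - xs)‖ < t * ‖N.starProjection (x - xs)‖}

theorem hasBasis_conicNhds : (conicNhds N xs).HasBasis (fun t : ℝ => 0 < t) fun t =>
    {x | ‖x - xs‖ < t ∧ ‖Nᗮ.starProjection (x - xs)‖ < t * ‖N.starProjection (x - xs)‖} := by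
  refine hasBasis_biInf_principal' (fun s hs t ht =>
    ⟨min s t, Set.mem_Ioi.2 (lt_min hs ht), ?_, ?_⟩) ⟨1, Set.mem_Ioi.2 one_pos⟩
  · exact fun x hx => ⟨hx.1.trans_le (min_le_left s t),
      hx.2.trans_le (mul_le_mul_of_nonneg_right (min_le_left s t) (norm_nonneg _))⟩
  · exact fun x hx => ⟨hx.1.trans_le (min_le_right s t),
      hx.2.trans_le (mul_le_mul_of_nonneg_right (min_le_right s t) (norm_nonneg _))⟩

theorem conicNhds_le_nhds : conicNhds N xs ≤ 𝓝 xs := by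
  refine Metric.nhds_basis_ball.ge_iff.2 fun t ht =>
    (hasBasis_conicNhds N xs).mem_of_mem ht |> Filter.mem_of_superset <| fun x hx => ?_
  exact mem_ball_iff_norm.2 hx.1

theorem eventually_conicNhds_pos : ∀ᶠ x in conicNhds N xs, 0 < ‖N.starProjection (x - xs)‖ := by
  filter_upwards [(hasBasis_conicNhds N xs).mem_of_mem one_pos] with x hx
  linarith [hx.2, norm_nonneg (Nᗮ.starProjection (x - xs))]

theorem orthogonal_isLittleO_conicNhds : (fun x => Nᗮ.starProjection (x - xs))
    =o[conicNhds N xs] fun x => N.starProjection (x - xs) := by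
  refine isLittleO_iff.2 fun c hc => ?_
  filter_upwards [(hasBasis_conicNhds N xs).mem_of_mem hc] with x hx
  exact hx.2.le

theorem sub_isBigO_conicNhds : (fun x => x - xs)
    =O[conicNhds N xs] fun x => N.starProjection (x - xs) :=
  ((isBigO_refl _ _).add (orthogonal_isLittleO_conicNhds N xs).isBigO).congr_left fun x =>
    N.starProjection_add_starProjection_orthogonal (x - xs)

theorem starProjection_sub_isBigO (l : Filter E) :
    (fun x => N.starProjection (x - xs)) =O[l] fun x => x - xs :=
  isBigO_of_le _ fun x => N.norm_starProjection_apply_le (x - xs)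

theorem tendsto_norm_sub_conicNhds : Tendsto (fun x => ‖x - xs‖) (conicNhds N xs) (𝓝 0) :=
  tendsto_iff_norm_sub_tendsto_zero.1 (tendsto_id'.2 (conicNhds_le_nhds N xs))

theorem norm_sub_sq_isLittleO_conicNhds : (fun x => ‖x - xs‖ ^ 2)
    =o[conicNhds N xs] fun x => N.starProjection (x - xs) := by
  have h := ((isLittleO_one_iff ℝ).2 (tendsto_norm_sub_conicNhds N xs)).mul_isBigO
    (sub_isBigO_conicNhds N xs).norm_norm
  simpa only [sq, one_mul, isLittleO_norm_right] using h

end Cone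

section Mixing

variable {E : Type*} [NormedAddCommGroup E] [InnerProductSpace ℝ E]

/-- A step `w` from an error `e` that behaves like a Newton step at a singular root with null
space `N`: it removes half of the component of `e` in `N`, up to a relative error `ε`, and leaves a
quadratically small component in `Nᗮ`. -/
structure IsNewtonStep (N : Submodule ℝ E) [N.HasOrthogonalProjection] (ε C : ℝ) (e w : E) :
    Prop where
  pos : 0 < ‖N.starProjection e‖
  norm_le : ‖e‖ ≤ 2 * ‖N.starProjection e‖
  norm_add_half_smul_le : ‖w + (1 / 2 : ℝ) • N.starProjection e‖ ≤ ε * ‖N.starProjection e‖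
  norm_orthogonal_le : ‖Nᗮ.starProjection (e + w)‖ ≤ C * ‖e‖ ^ 2

/-- `μ` is an admissible mixing weight for the successive updates `w` and `w'`: mixing does not
increase the size of the update, and the contribution of the old update is at most the fraction `r`
of the contribution of the new one. -/
structure IsSafeguarded (r : ℝ) (w w' : E) (μ : ℝ) : Prop where
  norm_sub_smul_le : ‖w' - μ • (w' - w)‖ ≤ ‖w'‖
  abs_mul_norm_le : |μ| * ‖w‖ ≤ r * (|1 - μ| * ‖w'‖)

theorem isSafeguarded_zero {r : ℝ} (hr : 0 ≤ r) (w w' : E) : IsSafeguarded r w w' 0 where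
  norm_sub_smul_le := by simp
  abs_mul_norm_le := by
    simp only [abs_zero, zero_mul]
    positivity

namespace IsNewtonStep

variable {N : Submodule ℝ E} [N.HasOrthogonalProjection] {ε C r μ M K : ℝ} {e w e' w' : E}

theorem eps_nonneg (h : IsNewtonStep N ε C e w) : 0 ≤ ε :=
  nonneg_of_mul_nonneg_left ((norm_nonneg _).trans h.norm_add_half_smul_le) h.pos

theorem norm_pos (h : IsNewtonStep N ε C e w) : 0 < ‖e‖ :=
  h.pos.trans_le (N.norm_starProjection_apply_le e)

theorem const_nonneg (h : IsNewtonStep N ε C e w) : 0 ≤ C :=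
  nonneg_of_mul_nonneg_left ((norm_nonneg _).trans h.norm_orthogonal_le) (pow_pos h.norm_pos 2)

theorem mul_norm_le_norm_update (h : IsNewtonStep N ε C e w) :
    (1 / 2 - ε) * ‖N.starProjection e‖ ≤ ‖w‖ := by
  have htri := norm_sub_le (w + (1 / 2 : ℝ) • N.starProjection e) w
  rw [add_sub_cancel_left, norm_smul, Real.norm_of_nonneg one_half_pos.le] at htri
  linarith [h.norm_add_half_smul_le]

theorem norm_update_le (h : IsNewtonStep N ε C e w) :
    ‖w‖ ≤ (1 / 2 + ε) * ‖N.starProjection e‖ := by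
  have htri := norm_sub_le (w + (1 / 2 : ℝ) • N.starProjection e) ((1 / 2 : ℝ) • N.starProjection e)
  rw [add_sub_cancel_right, norm_smul, Real.norm_of_nonneg one_half_pos.le] at htri
  linarith [h.norm_add_half_smul_le]

theorem norm_update_pos (h : IsNewtonStep N ε C e w) (hε : ε < 1 / 2) : 0 < ‖w‖ :=
  (mul_pos (sub_pos.2 hε) h.pos).trans_le h.mul_norm_le_norm_update

theorem sub_mul_abs_le_gain (h' : IsNewtonStep N ε C e' w') (hμ : IsSafeguarded r w w' μ)
    (hε : ε < 1 / 2) :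
    (1 - r) * |1 - μ| ≤ ‖w' - μ • (w' - w)‖ / ‖w'‖ := by
  have htri := norm_sub_le (w' - μ • (w' - w)) (μ • w)
  rw [show w' - μ • (w' - w) - μ • w = (1 - μ) • w' by module, norm_smul, norm_smul,
    Real.norm_eq_abs, Real.norm_eq_abs] at htri
  rw [le_div_iff₀ (h'.norm_update_pos hε)]
  linarith [hμ.abs_mul_norm_le]

theorem one_sub_ne_zero (h : IsNewtonStep N ε C e w) (hμ : IsSafeguarded r w w' μ)
    (hε : ε < 1 / 2) : 1 - μ ≠ 0 := by
  intro h1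
  have hle := hμ.abs_mul_norm_le
  rw [h1, abs_zero, zero_mul, mul_zero, ← sub_eq_zero.1 h1, abs_one, one_mul] at hle
  exact hle.not_gt (h.norm_update_pos hε)

theorem update_ne (h : IsNewtonStep N ε C e w) (h' : IsNewtonStep N ε C e' w') (hε : ε ≤ 1 / 64)
    (hle : ‖N.starProjection e'‖ ≤ 3 / 4 * ‖N.starProjection e‖) : w' ≠ w := by
  refine fun heq => lt_irrefl ‖w'‖ ?_
  calc ‖w'‖ ≤ (1 / 2 + ε) * ‖N.starProjection e'‖ := h'.norm_update_le
    _ ≤ (1 / 2 + 1 / 64) * (3 / 4 * ‖N.starProjection e‖) := by gcongr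
    _ < (1 / 2 - 1 / 64) * ‖N.starProjection e‖ := by linarith [h.pos]
    _ ≤ (1 / 2 - ε) * ‖N.starProjection e‖ := by gcongr
    _ ≤ ‖w‖ := h.mul_norm_le_norm_update
    _ = ‖w'‖ := by rw [heq]

variable (h : IsNewtonStep N ε C e w) (h' : IsNewtonStep N ε C e' w')
  (hμ : IsSafeguarded r w w' μ)
include h h'

theorem norm_mixed_remainder_le :
    ‖(1 - μ) • (w' + (1 / 2 : ℝ) • N.starProjection e') +
        μ • (w + (1 / 2 : ℝ) • N.starProjection e)‖ ≤
      ε * (|1 - μ| * ‖N.starProjection e'‖ + |μ| * ‖N.starProjection e‖) := by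
  calc _ ≤ |1 - μ| * ‖w' + (1 / 2 : ℝ) • N.starProjection e'‖ +
        |μ| * ‖w + (1 / 2 : ℝ) • N.starProjection e‖ := by
        refine (norm_add_le _ _).trans_eq ?_
        rw [norm_smul, norm_smul, Real.norm_eq_abs, Real.norm_eq_abs]
    _ ≤ |1 - μ| * (ε * ‖N.starProjection e'‖) + |μ| * (ε * ‖N.starProjection e‖) := by
        gcongr
        exacts [h'.norm_add_half_smul_le, h.norm_add_half_smul_le]
    _ = _ := by ring

theorem sub_le_norm_starProjection_mix :
    (1 / 2 - ε) * (|1 - μ| * ‖N.starProjection e'‖) - (1 / 2 + ε) * (|μ| * ‖N.starProjection e‖) ≤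
      ‖N.starProjection ((1 - μ) • (e' + w') + μ • (e + w))‖ := by
  have hdecomp : N.starProjection ((1 - μ) • (e' + w') + μ • (e + w)) =
      (1 / 2 : ℝ) • ((1 - μ) • N.starProjection e' + μ • N.starProjection e) +
        N.starProjection ((1 - μ) • (w' + (1 / 2 : ℝ) • N.starProjection e') +
          μ • (w + (1 / 2 : ℝ) • N.starProjection e)) := by
    simp only [map_add, map_smul, starProjection_starProjection]
    module
  have hrem := (N.norm_starProjection_apply_le _).trans (h.norm_mixed_remainder_le h' (μ := μ))
  have hmain : |1 - μ| * ‖N.starProjection e'‖ - |μ| * ‖N.starProjection e‖ ≤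
      ‖(1 - μ) • N.starProjection e' + μ • N.starProjection e‖ := by
    rw [← Real.norm_eq_abs, ← Real.norm_eq_abs, ← norm_smul, ← norm_smul]
    exact norm_sub_le_norm_add _ _
  rw [hdecomp]
  refine le_trans ?_ (norm_sub_le_norm_add _ _)
  rw [norm_smul, Real.norm_of_nonneg one_half_pos.le]
  linarith

-- Since `P_N e ≈ -2 w`, the null component of the new error is, up to sign, the mixed update.
theorem norm_starProjection_mix_le_add :
    ‖N.starProjection ((1 - μ) • (e' + w') + μ • (e + w))‖ ≤ ‖w' - μ • (w' - w)‖ +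
      2 * (ε * (|1 - μ| * ‖N.starProjection e'‖ + |μ| * ‖N.starProjection e‖)) := by
  have hdecomp : N.starProjection ((1 - μ) • (e' + w') + μ • (e + w)) =
      (2 : ℝ) • N.starProjection ((1 - μ) • (w' + (1 / 2 : ℝ) • N.starProjection e') +
          μ • (w + (1 / 2 : ℝ) • N.starProjection e)) -
        N.starProjection (w' - μ • (w' - w)) := by
    simp only [map_add, map_sub, map_smul, starProjection_starProjection]
    module
  have hrem := (N.norm_starProjection_apply_le _).trans (h.norm_mixed_remainder_le h' (μ := μ))
  rw [hdecomp]
  refine (norm_sub_le _ _).trans ?_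
  rw [norm_smul, Real.norm_of_nonneg two_pos.le]
  linarith [N.norm_starProjection_apply_le (w' - μ • (w' - w))]

theorem norm_orthogonal_mix_le :
    ‖Nᗮ.starProjection ((1 - μ) • (e' + w') + μ • (e + w))‖ ≤
      C * (|1 - μ| * ‖e'‖ ^ 2 + |μ| * ‖e‖ ^ 2) := by
  calc _ ≤ |1 - μ| * ‖Nᗮ.starProjection (e' + w')‖ + |μ| * ‖Nᗮ.starProjection (e + w)‖ := by
        rw [map_add _ ((1 - μ) • (e' + w')), map_smul, map_smul]
        refine (norm_add_le _ _).trans_eq ?_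
        rw [norm_smul, norm_smul, Real.norm_eq_abs, Real.norm_eq_abs]
    _ ≤ |1 - μ| * (C * ‖e'‖ ^ 2) + |μ| * (C * ‖e‖ ^ 2) := by
        gcongr
        exacts [h'.norm_orthogonal_le, h.norm_orthogonal_le]
    _ = _ := by ring

theorem norm_orthogonal_mix_le_max :
    ‖Nᗮ.starProjection ((1 - μ) • (e' + w') + μ • (e + w))‖ ≤
      2 * C * max (|1 - μ| * ‖e'‖ ^ 2) (|μ| * ‖e‖ ^ 2) := by
  refine (h.norm_orthogonal_mix_le h').trans ?_
  rw [mul_assoc, mul_left_comm, two_mul]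
  gcongr
  exacts [h.const_nonneg, le_max_left _ _, le_max_right _ _]

variable (hr : 0 ≤ r)
include hμ hr

theorem mul_abs_mul_norm_le :
    (1 / 2 - ε) * (|μ| * ‖N.starProjection e‖) ≤
      r * (1 / 2 + ε) * (|1 - μ| * ‖N.starProjection e'‖) := by
  calc _ = |μ| * ((1 / 2 - ε) * ‖N.starProjection e‖) := by ring
    _ ≤ |μ| * ‖w‖ := by gcongr; exact h.mul_norm_le_norm_update
    _ ≤ r * (|1 - μ| * ‖w'‖) := hμ.abs_mul_norm_le
    _ ≤ r * (|1 - μ| * ((1 / 2 + ε) * ‖N.starProjection e'‖)) := by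
        gcongr; exact h'.norm_update_le
    _ = _ := by ring

variable (hε : 64 * ε ≤ 1 - r)
include hε

theorem abs_mul_norm_le_two_mul :
    |μ| * ‖N.starProjection e‖ ≤ 2 * (|1 - μ| * ‖N.starProjection e'‖) := by
  have hε0 := h.eps_nonneg
  have hY : 0 ≤ |1 - μ| * ‖N.starProjection e'‖ := by positivity
  have hcoef : r * (1 / 2 + ε) ≤ 1 / 2 + ε := mul_le_of_le_one_left (by linarith) (by linarith)
  have hmix := (h.mul_abs_mul_norm_le h' hμ hr).trans (mul_le_mul_of_nonneg_right hcoef hY)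
  nlinarith [mul_nonneg (abs_nonneg μ) (norm_nonneg (N.starProjection e))]

theorem mul_norm_le_norm_starProjection_mix :
    (1 - r) / 4 * (|1 - μ| * ‖N.starProjection e'‖) ≤
      ‖N.starProjection ((1 - μ) • (e' + w') + μ • (e + w))‖ := by
  have hε0 := h.eps_nonneg
  have hlow := h.sub_le_norm_starProjection_mix h' (μ := μ)
  have hXY := h.mul_abs_mul_norm_le h' hμ hr
  set X := |μ| * ‖N.starProjection e‖
  set Y := |1 - μ| * ‖N.starProjection e'‖
  have hcoef : (1 / 2 - ε) * ((1 - r) / 4) ≤ (1 / 2 - ε) ^ 2 - r * (1 / 2 + ε) ^ 2 := by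
    nlinarith [mul_nonneg hε0 hr, mul_nonneg hε0 hε0]
  refine le_of_mul_le_mul_left ?_ (by linarith : 0 < 1 / 2 - ε)
  calc (1 / 2 - ε) * ((1 - r) / 4 * Y) ≤ ((1 / 2 - ε) ^ 2 - r * (1 / 2 + ε) ^ 2) * Y := by
        rw [← mul_assoc]
        gcongr
    _ = (1 / 2 - ε) * ((1 / 2 - ε) * Y) - (1 / 2 + ε) * (r * (1 / 2 + ε) * Y) := by ring
    _ ≤ (1 / 2 - ε) * ((1 / 2 - ε) * Y) - (1 / 2 + ε) * ((1 / 2 - ε) * X) := by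
        gcongr
    _ = (1 / 2 - ε) * ((1 / 2 - ε) * Y - (1 / 2 + ε) * X) := by ring
    _ ≤ _ := by
        gcongr
        linarith

theorem norm_starProjection_mix_le :
    ‖N.starProjection ((1 - μ) • (e' + w') + μ • (e + w))‖ ≤
      3 / 4 * (‖w' - μ • (w' - w)‖ / ‖w'‖) * ‖N.starProjection e'‖ := by
  have hε0 := h.eps_nonneg
  have hε2 : ε < 1 / 2 := by linarith
  set g := ‖w' - μ • (w' - w)‖ / ‖w'‖
  have hg0 : 0 ≤ g := by positivity
  have hrem : ε * (|1 - μ| * ‖N.starProjection e'‖ + |μ| * ‖N.starProjection e‖) ≤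
      3 / 64 * (g * ‖N.starProjection e'‖) :=
    calc _ ≤ (1 - r) / 64 * (3 * (|1 - μ| * ‖N.starProjection e'‖)) := by
          gcongr
          · linarith
          · linarith
          · linarith [h.abs_mul_norm_le_two_mul h' hμ hr hε]
      _ = 3 / 64 * ((1 - r) * |1 - μ| * ‖N.starProjection e'‖) := by ring
      _ ≤ _ := by
          gcongr
          exact h'.sub_mul_abs_le_gain hμ hε2
  calc _ ≤ g * ‖w'‖ +
          2 * (ε * (|1 - μ| * ‖N.starProjection e'‖ + |μ| * ‖N.starProjection e‖)) := by
        rw [div_mul_cancel₀ _ (h'.norm_update_pos hε2).ne']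
        exact h.norm_starProjection_mix_le_add h'
    _ ≤ g * ((1 / 2 + 1 / 64) * ‖N.starProjection e'‖) +
          2 * (3 / 64 * (g * ‖N.starProjection e'‖)) := by
        gcongr
        refine h'.norm_update_le.trans ?_
        gcongr
        linarith
    _ ≤ 3 / 4 * g * ‖N.starProjection e'‖ := by
        linarith [mul_nonneg hg0 (norm_nonneg (N.starProjection e'))]

theorem norm_orthogonal_mix_le_mul (heM : ‖e‖ ≤ M) (heM' : ‖e'‖ ≤ M) (hK : 0 ≤ K)
    (hCK : 24 * C ≤ (1 - r) * K) :
    ‖Nᗮ.starProjection ((1 - μ) • (e' + w') + μ • (e + w))‖ ≤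
      K * M * ‖N.starProjection ((1 - μ) • (e' + w') + μ • (e + w))‖ := by
  have hC := h.const_nonneg
  have hM : 0 ≤ M := (norm_nonneg e).trans heM
  calc _ ≤ C * (|1 - μ| * ‖e'‖ ^ 2 + |μ| * ‖e‖ ^ 2) := h.norm_orthogonal_mix_le h'
    _ ≤ C * (|1 - μ| * (M * (2 * ‖N.starProjection e'‖)) +
          |μ| * (M * (2 * ‖N.starProjection e‖))) := by
        simp only [sq]
        gcongr
        exacts [h'.norm_le, h.norm_le]
    _ = 2 * C * M * (|1 - μ| * ‖N.starProjection e'‖ + |μ| * ‖N.starProjection e‖) := by ring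
    _ ≤ 2 * C * M * (3 * (|1 - μ| * ‖N.starProjection e'‖)) := by
        gcongr
        linarith [h.abs_mul_norm_le_two_mul h' hμ hr hε]
    _ = 24 * C * M * (|1 - μ| * ‖N.starProjection e'‖ / 4) := by ring
    _ ≤ (1 - r) * K * M * (|1 - μ| * ‖N.starProjection e'‖ / 4) := by gcongr
    _ = K * M * ((1 - r) / 4 * (|1 - μ| * ‖N.starProjection e'‖)) := by ring
    _ ≤ _ := by
        gcongr
        exact h.mul_norm_le_norm_starProjection_mix h' hμ hr hε

end IsNewtonStep

end Mixing

section SingularRoot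

variable {E : Type*} [NormedAddCommGroup E] [InnerProductSpace ℝ E]
  {N : Submodule ℝ E} [N.HasOrthogonalProjection] {f : E → E} {xs : E} {m d : ℝ}

/-- A root `xs` of `f` at which `f'(xs)` is singular along `N` only, with range in `Nᗮ` and lower
bound `m` there, while the component of `f''(xs)` in `N` is nonsingular on `N`, with lower bound
`d`. -/
structure IsSingularRoot (N : Submodule ℝ E) [N.HasOrthogonalProjection] (f : E → E) (xs : E)
    (m d : ℝ) : Prop where
  root : f xs = 0
  eventually_differentiableAt : ∀ᶠ x in 𝓝 xs, DifferentiableAt ℝ f x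
  differentiableAt_fderiv : DifferentiableAt ℝ (fderiv ℝ f) xs
  fderiv_apply_eq_zero (v : E) : v ∈ N → fderiv ℝ f xs v = 0
  fderiv_apply_mem (v : E) : fderiv ℝ f xs v ∈ Nᗮ
  mul_norm_le_fderiv (v : E) : m * ‖Nᗮ.starProjection v‖ ≤ ‖fderiv ℝ f xs v‖
  mul_norm_le_fderiv_fderiv (u v : E) : u ∈ N → v ∈ N →
    d * ‖u‖ * ‖v‖ ≤ ‖N.starProjection (fderiv ℝ (fderiv ℝ f) xs u v)‖
  m_pos : 0 < m
  d_pos : 0 < d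

namespace IsSingularRoot

variable (h : IsSingularRoot N f xs m d)
include h

theorem fderiv_apply_eq (v : E) :
    fderiv ℝ f xs v = fderiv ℝ f xs (Nᗮ.starProjection v) := by
  conv_lhs => rw [← N.starProjection_add_starProjection_orthogonal v, map_add,
    h.fderiv_apply_eq_zero _ (N.starProjection_apply_mem v), zero_add]

theorem fderiv_sub_isLittleO :
    (fun x => fderiv ℝ f x - fderiv ℝ f xs - fderiv ℝ (fderiv ℝ f) xs (x - xs))
      =o[conicNhds N xs] fun x => N.starProjection (x - xs) :=
  ((hasFDerivAt_iff_isLittleO.1 h.differentiableAt_fderiv.hasFDerivAt).mono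
    (conicNhds_le_nhds N xs)).trans_isBigO (sub_isBigO_conicNhds N xs)

theorem eventually_mul_norm_le_block : ∀ᶠ x in conicNhds N xs, ∀ v ∈ N,
    d / 2 * ‖N.starProjection (x - xs)‖ * ‖v‖ ≤ ‖N.starProjection (fderiv ℝ f x v)‖ := by
  set B := fderiv ℝ (fderiv ℝ f) xs with hB
  have hrem : (fun x => B (Nᗮ.starProjection (x - xs)) +
      (fderiv ℝ f x - fderiv ℝ f xs - B (x - xs)))
      =o[conicNhds N xs] fun x => N.starProjection (x - xs) :=
    ((B.isBigO_comp _ _).trans_isLittleO (orthogonal_isLittleO_conicNhds N xs)).add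
      h.fderiv_sub_isLittleO
  filter_upwards [hrem.def (half_pos h.d_pos)] with x hx v hv
  have hmain : B (N.starProjection (x - xs)) v = fderiv ℝ f x v -
      (B (Nᗮ.starProjection (x - xs)) + (fderiv ℝ f x - fderiv ℝ f xs - B (x - xs))) v := by
    have hsum := congrArg (fun u => B u v) (N.starProjection_add_starProjection_orthogonal (x - xs))
    simp only [map_add, add_apply] at hsum
    simp only [add_apply, sub_apply, h.fderiv_apply_eq_zero v hv, ← hsum]
    abel
  have hlow := h.mul_norm_le_fderiv_fderiv _ v (N.starProjection_apply_mem (x - xs)) hv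
  rw [← hB, hmain, map_sub _ (fderiv ℝ f x v)] at hlow
  have hlow := hlow.trans (norm_sub_le _ _)
  have hrem := (N.norm_starProjection_apply_le _).trans
    (ContinuousLinearMap.le_of_opNorm_le _ hx v)
  linarith

theorem exists_eventually_isSingularPerturbation : ∃ b > 0, ∀ᶠ x in conicNhds N xs,
    IsSingularPerturbation N (fderiv ℝ f xs) (fderiv ℝ f x) m (b * ‖x - xs‖)
      (d / 2 * ‖N.starProjection (x - xs)‖) := by
  have hm := h.m_pos
  have hd := h.d_pos
  obtain ⟨b, hb, hfderiv⟩ := h.differentiableAt_fderiv.isBigO_sub.exists_pos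
  refine ⟨b, hb, ?_⟩
  have htendsto := tendsto_norm_sub_conicNhds N xs
  have hsmall : ∀ᶠ x in conicNhds N xs, 2 * (b * ‖x - xs‖) ≤ m := by
    have : Tendsto (fun x => 2 * (b * ‖x - xs‖)) (conicNhds N xs) (𝓝 0) := by
      simpa using (htendsto.const_mul b).const_mul 2
    exact this.eventually_le_const hm
  have hsq : ∀ᶠ x in conicNhds N xs,
      4 * (b * ‖x - xs‖) ^ 2 ≤ d / 2 * ‖N.starProjection (x - xs)‖ * m := by
    filter_upwards [(norm_sub_sq_isLittleO_conicNhds N xs).def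
      (by positivity : 0 < d / 2 * m / (4 * b ^ 2))] with x hx
    rw [norm_pow, norm_norm, div_mul_eq_mul_div, le_div_iff₀ (by positivity)] at hx
    linarith
  filter_upwards [hsmall, hsq, hfderiv.bound.filter_mono (conicNhds_le_nhds N xs),
    h.eventually_mul_norm_le_block, eventually_conicNhds_pos N xs]
    with x hsmall hsq hfderiv hblock hpos
  exact ⟨h.fderiv_apply_mem, h.mul_norm_le_fderiv, hfderiv, hblock, hm, by positivity, hsmall, hsq⟩

theorem trapezoid_isLittleO :
    (fun x => f x - (1 / 2 : ℝ) • (fderiv ℝ f x (x - xs) + fderiv ℝ f xs (x - xs)))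
      =o[conicNhds N xs] fun x => ‖x - xs‖ ^ 2 := by
  simpa only [h.root, sub_zero] using
    (trapezoid_sub_isLittleO h.eventually_differentiableAt h.differentiableAt_fderiv).mono
      (conicNhds_le_nhds N xs)

theorem newton_error_isLittleO {w : E → E}
    (hw : ∀ᶠ x in conicNhds N xs, fderiv ℝ f x (w x) = -f x) :
    (fun x => N.starProjection (w x + (1 / 2 : ℝ) • (x - xs)))
      =o[conicNhds N xs] fun x => N.starProjection (x - xs) := by
  obtain ⟨b, hb, hpert⟩ := h.exists_eventually_isSingularPerturbation
  have hm := h.m_pos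
  have hd := h.d_pos
  have htrap := h.trapezoid_isLittleO.trans_isBigO ((sub_isBigO_conicNhds N xs).norm_norm.pow 2)
  have hA : (fun x => ‖x - xs‖ * ‖fderiv ℝ f xs (x - xs)‖)
      =o[conicNhds N xs] fun x => ‖N.starProjection (x - xs)‖ ^ 2 := by
    simp only [sq, h.fderiv_apply_eq (_ - xs)]
    exact (sub_isBigO_conicNhds N xs).norm_norm.mul_isLittleO
      (((fderiv ℝ f xs).isBigO_comp _ _).trans_isLittleO
        (orthogonal_isLittleO_conicNhds N xs)).norm_norm
  have hrhs := (htrap.norm_left.const_mul_left 2).add (hA.const_mul_left (b / m))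
  refine isLittleO_iff.2 fun c hc => ?_
  filter_upwards [hw, hpert, eventually_conicNhds_pos N xs,
    hrhs.def (by positivity : 0 < c * (d / 4))] with x hw hpert hpos hrhs
  have herr := hpert.newton_error_le (e := x - xs) hw
  rw [Real.norm_of_nonneg (by positivity), norm_pow, norm_norm] at hrhs
  rw [mul_div_right_comm b, mul_assoc (b / m)] at herr
  refine le_of_mul_le_mul_left ?_ (by positivity : 0 < d / 4 * ‖N.starProjection (x - xs)‖)
  linarith

theorem newton_error_orthogonal_isBigO {w : E → E}
    (hw : ∀ᶠ x in conicNhds N xs, fderiv ℝ f x (w x) = -f x) :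
    (fun x => Nᗮ.starProjection (x - xs + w x)) =O[conicNhds N xs] fun x => ‖x - xs‖ ^ 2 := by
  obtain ⟨b, -, hpert⟩ := h.exists_eventually_isSingularPerturbation
  have hm := h.m_pos
  have hN : (fun x => N.starProjection (x - xs + w x)) =O[conicNhds N xs] fun x => x - xs := by
    have hP := starProjection_sub_isBigO N xs (conicNhds N xs)
    refine (((h.newton_error_isLittleO hw).isBigO.trans hP).add
      (hP.const_smul_left (1 / 2 : ℝ))).congr_left fun x => ?_
    simp only [Pi.smul_apply, ← map_smul, ← map_add]
    congr 1
    module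
  have hNsq : (fun x => ‖x - xs‖ * ‖N.starProjection (x - xs + w x)‖)
      =O[conicNhds N xs] fun x => ‖x - xs‖ ^ 2 := by
    simpa only [sq] using (isBigO_refl (fun x => ‖x - xs‖) _).mul hN.norm_norm
  have hrhs := (h.trapezoid_isLittleO.isBigO.norm_left.add ((isBigO_refl (fun x => ‖x - xs‖ ^ 2)
    (conicNhds N xs)).const_mul_left (b / 2))).add (hNsq.const_mul_left b)
  refine (IsBigO.of_bound (m / 2)⁻¹ ?_).trans hrhs
  filter_upwards [hw, hpert] with x hw hpert
  have herr := hpert.newton_error_orthogonal_le (e := x - xs) hw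
  rw [le_inv_mul_iff₀ (by positivity)]
  refine herr.trans (le_of_eq_of_le ?_ (le_abs_self _))
  ring

theorem exists_eventually_isNewtonStep {w : E → E}
    (hw : ∀ᶠ x in conicNhds N xs, fderiv ℝ f x (w x) = -f x) :
    ∃ C > 0, ∀ ε > 0, ∀ᶠ x in conicNhds N xs, IsNewtonStep N ε C (x - xs) (w x) := by
  obtain ⟨C, hC, horth⟩ := (h.newton_error_orthogonal_isBigO hw).exists_pos
  refine ⟨C, hC, fun ε hε => ?_⟩
  have hQ := orthogonal_isLittleO_conicNhds N xs
  have hstep : (fun x => w x + (1 / 2 : ℝ) • N.starProjection (x - xs))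
      =o[conicNhds N xs] fun x => N.starProjection (x - xs) := by
    have hwQ := ((h.newton_error_orthogonal_isBigO hw).trans_isLittleO
      (norm_sub_sq_isLittleO_conicNhds N xs)).sub hQ
    refine ((h.newton_error_isLittleO hw).add hwQ).congr_left fun x => ?_
    rw [← map_sub, add_sub_cancel_left, map_add, map_smul, add_right_comm,
      N.starProjection_add_starProjection_orthogonal]
  filter_upwards [eventually_conicNhds_pos N xs, hQ.def one_pos, hstep.def hε, horth.bound]
    with x hpos hQ hstep horth
  refine ⟨hpos, ?_, hstep, by simpa using horth⟩
  linarith [norm_le_add_norm_starProjection_orthogonal (N := N) (x - xs)]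

end IsSingularRoot

end SingularRoot

theorem isInvertible_of_injective {E : Type*} [NormedAddCommGroup E] [NormedSpace ℝ E]
    [FiniteDimensional ℝ E] {L : E →L[ℝ] E} (hL : Function.Injective L) : L.IsInvertible :=
  ⟨(LinearEquiv.ofInjectiveEndo L.toLinearMap hL).toContinuousLinearEquiv, rfl⟩

theorem exists_mul_norm_mul_norm_le_of_nonsingular {E F G : Type*} [NormedAddCommGroup E]
    [NormedSpace ℝ E] [FiniteDimensional ℝ E] [NormedAddCommGroup F] [NormedSpace ℝ F]
    [FiniteDimensional ℝ F] [NormedAddCommGroup G] [NormedSpace ℝ G]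
    (B : E →L[ℝ] F →L[ℝ] G) (hB : ∀ u v, B u v = 0 → u = 0 ∨ v = 0) :
    ∃ d > 0, ∀ u v, d * ‖u‖ * ‖v‖ ≤ ‖B u v‖ := by
  obtain ⟨d, hd, hle⟩ : ∃ d > 0, ∀ u ∈ Metric.sphere (0 : E) 1, ∀ v ∈ Metric.sphere (0 : F) 1,
      d ≤ ‖B u v‖ := by
    have hcompact := (isCompact_sphere (0 : E) 1).prod (isCompact_sphere (0 : F) 1)
    obtain hempty | hne := (Metric.sphere (0 : E) 1 ×ˢ Metric.sphere (0 : F) 1).eq_empty_or_nonempty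
    · exact ⟨1, one_pos, fun u hu v hv => absurd (Set.mk_mem_prod hu hv) (by simp [hempty])⟩
    · obtain ⟨p, hp, hmin⟩ := hcompact.exists_isMinOn hne
        (f := fun p => ‖B p.1 p.2‖) (by fun_prop)
      refine ⟨‖B p.1 p.2‖, norm_pos_iff.2 fun h0 => ?_, fun u hu v hv =>
        isMinOn_iff.1 hmin (u, v) ⟨hu, hv⟩⟩
      rcases hB _ _ h0 with h | h
      · exact ne_zero_of_mem_unit_sphere ⟨p.1, hp.1⟩ h
      · exact ne_zero_of_mem_unit_sphere ⟨p.2, hp.2⟩ h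
  refine ⟨d, hd, fun u v => ?_⟩
  rcases eq_or_ne u 0 with rfl | hu
  · simp
  rcases eq_or_ne v 0 with rfl | hv
  · simp
  have h := hle (‖u‖⁻¹ • u) (by simp [norm_smul, hu]) (‖v‖⁻¹ • v) (by simp [norm_smul, hv])
  rw [map_smul, map_smul, smul_apply, norm_smul, norm_smul, norm_inv, norm_inv, norm_norm,
    norm_norm, inv_mul_eq_div, inv_mul_eq_div, le_div_iff₀ (norm_pos_iff.2 hv),
    le_div_iff₀ (norm_pos_iff.2 hu)] at h
  linarith

theorem exists_mul_norm_starProjection_ker_orthogonal_le {E F : Type*} [NormedAddCommGroup E]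
    [InnerProductSpace ℝ E] [FiniteDimensional ℝ E] [NormedAddCommGroup F] [NormedSpace ℝ F]
    (A : E →L[ℝ] F) :
    ∃ m > 0, ∀ v, m * ‖A.kerᗮ.starProjection v‖ ≤ ‖A v‖ := by
  have hker : (A.toLinearMap.domRestrict A.kerᗮ).ker = ⊥ := by
    rw [LinearMap.ker_domRestrict, ← Submodule.disjoint_iff_comap_eq_bot]
    exact A.ker.orthogonal_disjoint.symm
  obtain ⟨K, hK, hA⟩ := LinearMap.exists_antilipschitzWith _ hker
  have hproj (v : E) : A (A.kerᗮ.starProjection v) = A v := by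
    have hP : A (A.ker.starProjection v) = 0 := A.ker.starProjection_apply_mem v
    rw [Submodule.starProjection_orthogonal_val, map_sub, hP, sub_zero]
  refine ⟨(K : ℝ)⁻¹, by positivity, fun v => ?_⟩
  have h : ‖A.kerᗮ.starProjection v‖ ≤ K * ‖A (A.kerᗮ.starProjection v)‖ :=
    hA.le_mul_norm (map_zero _) (A.kerᗮ.orthogonalProjectionOnto v)
  rwa [inv_mul_le_iff₀ (by positivity), ← hproj v]

variable {n : ℕ}

section Safeguard

variable {r : ℝ} (w w' : EuclideanSpace ℝ (Fin n))

theorem safeguardTol_nonneg (hr : 0 ≤ r) : 0 ≤ safeguardTol r w w' := by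
  unfold safeguardTol
  positivity

theorem safeguardTol_mul_norm_le (hr : 0 ≤ r) : safeguardTol r w w' * ‖w‖ ≤ r * ‖w'‖ :=
  calc safeguardTol r w w' * ‖w‖ = min (‖w'‖ / ‖w‖) r * (‖w'‖ / ‖w‖ * ‖w‖) := by
        rw [safeguardTol, mul_assoc]
    _ ≤ r * ‖w'‖ := by
        gcongr
        · exact min_le_right _ _
        · rw [div_mul_eq_mul_div, mul_div_assoc]
          exact mul_le_of_le_one_right (norm_nonneg _) (div_self_le_one _)

theorem damping_mem_Icc_and_abs_eq {β γ : ℝ} (hβ : 0 ≤ β) (hγ0 : γ ≠ 0) (hγ1 : γ < 1)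
    (hβγ : β < |γ| / |1 - γ|) :
    β / (γ * (β + Real.sign γ)) ∈ Set.Icc (0 : ℝ) 1 ∧
      |β / (γ * (β + Real.sign γ)) * γ| = β * |1 - β / (γ * (β + Real.sign γ)) * γ| := by
  have hsign : |Real.sign γ| = 1 := by
    rcases Real.sign_apply_eq_of_ne_zero γ hγ0 with h | h <;> simp [h]
  have habs : Real.sign γ * γ = |γ| := by
    rw [← abs_of_nonneg (Real.sign_mul_nonneg γ), abs_mul, hsign, one_mul]
  have hden : β < γ * (β + Real.sign γ) := by
    rw [abs_of_pos (sub_pos.2 hγ1), lt_div_iff₀ (sub_pos.2 hγ1)] at hβγ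
    linarith
  have hne : β + Real.sign γ ≠ 0 := right_ne_zero_of_mul (hβ.trans_lt hden).ne'
  have hμ : β / (γ * (β + Real.sign γ)) * γ = β / (β + Real.sign γ) := by field_simp
  have hμ' : 1 - β / (β + Real.sign γ) = Real.sign γ / (β + Real.sign γ) := by
    field_simp
    ring
  refine ⟨⟨div_nonneg hβ (hβ.trans hden.le), div_le_one_of_le₀ hden.le (hβ.trans hden.le)⟩, ?_⟩
  rw [hμ, hμ', abs_div, abs_div, hsign, abs_of_nonneg hβ, mul_one_div]

theorem safeguardFactor_mem_Icc_and_abs_le (hr : 0 ≤ r) :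
    safeguardFactor r w w' ∈ Set.Icc (0 : ℝ) 1 ∧
      |safeguardFactor r w w' * anderson w w'| ≤
        safeguardTol r w w' * |1 - safeguardFactor r w w' * anderson w w'| := by
  have hβ := safeguardTol_nonneg w w' hr
  unfold safeguardFactor
  split_ifs with hγ hβγ
  · simpa using hβ
  · rw [not_or, not_le] at hγ
    have h := damping_mem_Icc_and_abs_eq hβ hγ.1 hγ.2 hβγ
    exact ⟨h.1, h.2.le⟩
  · rw [not_or, not_le] at hγ
    rw [not_lt, div_le_iff₀ (abs_pos.2 (sub_pos.2 hγ.2).ne')] at hβγ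
    simpa using hβγ

theorem norm_sub_smul_anderson_le {t : ℝ} (ht : t ∈ Set.Icc (0 : ℝ) 1) :
    ‖w' - (t * anderson w w') • (w' - w)‖ ≤ ‖w'‖ := by
  have hinner : inner ℝ (w' - w) w' = anderson w w' * ‖w' - w‖ ^ 2 := by
    rcases eq_or_ne (w' - w) 0 with h | h
    · simp [h]
    · rw [anderson, div_mul_cancel₀ _ (by positivity)]
  have hgap : 0 ≤ t * (2 - t) * (anderson w w' * ‖w' - w‖) ^ 2 :=
    mul_nonneg (mul_nonneg ht.1 (by linarith [ht.2])) (sq_nonneg _)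
  refine le_of_sq_le_sq ?_ (norm_nonneg _)
  calc ‖w' - (t * anderson w w') • (w' - w)‖ ^ 2
      = ‖w'‖ ^ 2 - t * (2 - t) * (anderson w w' * ‖w' - w‖) ^ 2 := by
        rw [norm_sub_sq_real, norm_smul, inner_smul_right, real_inner_comm, hinner, mul_pow,
          Real.norm_eq_abs, sq_abs]
        ring
    _ ≤ ‖w'‖ ^ 2 := sub_le_self _ hgap

theorem isSafeguarded_lamGamma (hr : 0 ≤ r)
    (f : EuclideanSpace ℝ (Fin n) → EuclideanSpace ℝ (Fin n)) (xp x : EuclideanSpace ℝ (Fin n)) :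
    IsSafeguarded r (newtonUpdate f xp) (newtonUpdate f x) (lamGamma f r xp x) := by
  set w := newtonUpdate f xp
  set w' := newtonUpdate f x
  obtain ⟨hmem, habs⟩ := safeguardFactor_mem_Icc_and_abs_le w w' hr
  refine ⟨norm_sub_smul_anderson_le w w' hmem, ?_⟩
  calc |lamGamma f r xp x| * ‖w‖ ≤ safeguardTol r w w' * |1 - lamGamma f r xp x| * ‖w‖ := by
        gcongr
        exact habs
    _ = safeguardTol r w w' * ‖w‖ * |1 - lamGamma f r xp x| := by ring
    _ ≤ r * ‖w'‖ * |1 - lamGamma f r xp x| :=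
        mul_le_mul_of_nonneg_right (safeguardTol_mul_norm_le w w' hr) (abs_nonneg _)
    _ = r * (|1 - lamGamma f r xp x| * ‖w'‖) := by ring

end Safeguard

section Iteration

variable {f : EuclideanSpace ℝ (Fin n) → EuclideanSpace ℝ (Fin n)}
  {xs x0 xp x y : EuclideanSpace ℝ (Fin n)} {r ρ σ C K M μ : ℝ}

theorem projR_eq (hortho : rangeSp f xs ⟂ nullSp f xs) :
    projR f xs = (nullSp f xs)ᗮ.starProjection := by
  have hle := Submodule.isOrtho_iff_le.1 hortho
  have hrank : Module.finrank ℝ (rangeSp f xs) = Module.finrank ℝ (nullSp f xs)ᗮ := by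
    have hker : Module.finrank ℝ (rangeSp f xs) + Module.finrank ℝ (nullSp f xs) = _ :=
      LinearMap.finrank_range_add_finrank_ker _
    have hcompl := (nullSp f xs).finrank_add_finrank_orthogonal
    omega
  simp only [projR, Submodule.eq_of_le_of_finrank_eq hle hrank]

theorem mem_region_iff (hortho : rangeSp f xs ⟂ nullSp f xs) : x ∈ region f xs ρ σ ↔
    ‖x - xs‖ < ρ ∧ ‖(nullSp f xs)ᗮ.starProjection (x - xs)‖ <
      σ * ‖(nullSp f xs).starProjection (x - xs)‖ := by
  rw [← projR_eq hortho, ← mem_ball_iff_norm]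
  rfl

theorem region_mono {ρ' σ' : ℝ} (hρ : ρ ≤ ρ') (hσ : σ ≤ σ') :
    region f xs ρ σ ⊆ region f xs ρ' σ' := fun _ hy =>
  ⟨Metric.ball_subset_ball hρ hy.1, hy.2.trans_le (mul_le_mul_of_nonneg_right hσ (norm_nonneg _))⟩

/-- The mixing weight `λ γ` of the step from `x_k` to `x_{k+1}`. The first step is a plain Newton
step, hence has weight `0`. -/
noncomputable def weight (f : EuclideanSpace ℝ (Fin n) → EuclideanSpace ℝ (Fin n)) (r : ℝ)
    (x0 : EuclideanSpace ℝ (Fin n)) : ℕ → ℝ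
  | 0 => 0
  | k + 1 => lamGamma f r (iter f r x0 k) (iter f r x0 (k + 1))

theorem isSafeguarded_weight (hr : 0 ≤ r) (k : ℕ) :
    IsSafeguarded r (newtonUpdate f (iter f r x0 (k - 1))) (newtonUpdate f (iter f r x0 k))
      (weight f r x0 k) := by
  cases k with
  | zero => exact isSafeguarded_zero hr _ _
  | succ k => exact isSafeguarded_lamGamma hr f _ _

-- At `k = 0` the truncated predecessor `x_{k-1}` enters with weight `0`.
theorem iter_succ_sub (k : ℕ) : iter f r x0 (k + 1) - xs =
    (1 - weight f r x0 k) • (iter f r x0 k - xs + newtonUpdate f (iter f r x0 k)) +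
      weight f r x0 k •
        (iter f r x0 (k - 1) - xs + newtonUpdate f (iter f r x0 (k - 1))) := by
  cases k with
  | zero =>
    simp only [weight, iter]
    module
  | succ k =>
    simp only [weight, iter, Nat.add_sub_cancel]
    module

/-- The region `W(ρ, σ)` is a basin of attraction of the safeguarded iteration: throughout it the
Newton update is that of a singular root, with a relative error that a safeguard of level `r`
tolerates, and it is so small that an iteration started in it keeps its relative range component
below `K ρ ≤ σ`. -/
structure IsNewtonBasin (f : EuclideanSpace ℝ (Fin n) → EuclideanSpace ℝ (Fin n))
    (xs : EuclideanSpace ℝ (Fin n)) (r ρ σ C K : ℝ) : Prop where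
  isOrtho : rangeSp f xs ⟂ nullSp f xs
  isInvertible (x : EuclideanSpace ℝ (Fin n)) : x ∈ region f xs ρ σ → (fderiv ℝ f x).IsInvertible
  isNewtonStep (x : EuclideanSpace ℝ (Fin n)) : x ∈ region f xs ρ σ →
    IsNewtonStep (nullSp f xs) ((1 - r) / 64) C (x - xs) (newtonUpdate f x)
  nonneg : 0 ≤ r
  lt_one : r < 1
  ρ_pos : 0 < ρ
  σ_pos : 0 < σ
  σ_le : σ ≤ 1 / 3
  C_pos : 0 < C
  K_pos : 0 < K
  mul_C_le : 24 * C ≤ (1 - r) * K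
  K_mul_le : K * ρ ≤ σ

namespace IsNewtonBasin

variable (h : IsNewtonBasin f xs r ρ σ C K)
include h

theorem mix_mem_region (hxp : xp ∈ region f xs ρ σ) (hx : x ∈ region f xs ρ σ)
    (hxpM : ‖xp - xs‖ ≤ M) (hxM : ‖x - xs‖ ≤ M) (hM : M < ρ)
    (hμ : IsSafeguarded r (newtonUpdate f xp) (newtonUpdate f x) μ)
    (hy : y - xs = (1 - μ) • (x - xs + newtonUpdate f x) + μ • (xp - xs + newtonUpdate f xp)) :
    y ∈ region f xs ρ σ ∧ ‖y - xs‖ ≤ M ∧ sigma f xs y ≤ K * M ∧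
      ‖projN f xs (y - xs)‖ ≤ 3 / 4 * ‖projN f xs (x - xs)‖ := by
  have hp := h.isNewtonStep xp hxp
  have hc := h.isNewtonStep x hx
  have hε : 64 * ((1 - r) / 64) ≤ 1 - r := by linarith
  have hε2 : (1 - r) / 64 < 1 / 2 := by linarith [h.nonneg]
  have hr : 0 < 1 - r := sub_pos.2 h.lt_one
  have hlow := hp.mul_norm_le_norm_starProjection_mix hc hμ h.nonneg hε
  have hup := hp.norm_starProjection_mix_le hc hμ h.nonneg hε
  have horth := hp.norm_orthogonal_mix_le_mul hc hμ h.nonneg hε hxpM hxM h.K_pos.le h.mul_C_le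
  rw [← hy] at hlow hup horth
  have hpos : 0 < ‖(nullSp f xs).starProjection (y - xs)‖ :=
    (mul_pos (by positivity)
      (mul_pos (abs_pos.2 (hp.one_sub_ne_zero hμ hε2)) hc.pos)).trans_le hlow
  have hcontr : ‖(nullSp f xs).starProjection (y - xs)‖ ≤
      3 / 4 * ‖(nullSp f xs).starProjection (x - xs)‖ := by
    refine hup.trans (mul_le_mul_of_nonneg_right ?_ (norm_nonneg _))
    exact mul_le_of_le_one_right (by norm_num)
      (div_le_one_of_le₀ hμ.norm_sub_smul_le (norm_nonneg _))
  have hKM : K * M < σ := (mul_lt_mul_of_pos_left hM h.K_pos).trans_le h.K_mul_le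
  have hcone : ‖(nullSp f xs)ᗮ.starProjection (y - xs)‖ <
      σ * ‖(nullSp f xs).starProjection (y - xs)‖ :=
    horth.trans_lt (mul_lt_mul_of_pos_right hKM hpos)
  have hyM : ‖y - xs‖ ≤ M := by
    have hσ := mul_le_mul_of_nonneg_right h.σ_le hpos.le
    have hx := (nullSp f xs).norm_starProjection_apply_le (x - xs)
    linarith [norm_le_add_norm_starProjection_orthogonal (N := nullSp f xs) (y - xs)]
  refine ⟨(mem_region_iff h.isOrtho).2 ⟨hyM.trans_lt hM, hcone⟩, hyM, ?_, hcontr⟩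
  rw [sigma, projR_eq h.isOrtho, div_le_iff₀ (by exact hpos)]
  exact horth

variable (hx0 : x0 ∈ region f xs ρ σ)
include hx0

theorem iter_mem_region_and_norm_le (k : ℕ) :
    (iter f r x0 (k - 1) ∈ region f xs ρ σ ∧ ‖iter f r x0 (k - 1) - xs‖ ≤ ‖x0 - xs‖) ∧
      iter f r x0 k ∈ region f xs ρ σ ∧ ‖iter f r x0 k - xs‖ ≤ ‖x0 - xs‖ := by
  induction k with
  | zero => exact ⟨⟨hx0, le_rfl⟩, hx0, le_rfl⟩
  | succ k ih =>
    obtain ⟨hprev, hcur⟩ := ih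
    have hnext := h.mix_mem_region hprev.1 hcur.1 hprev.2 hcur.2 (mem_ball_iff_norm.1 hx0.1)
      (isSafeguarded_weight h.nonneg k) (iter_succ_sub k)
    exact ⟨hcur, hnext.1, hnext.2.1⟩

theorem iter_mem_region (k : ℕ) : iter f r x0 k ∈ region f xs ρ σ :=
  (h.iter_mem_region_and_norm_le hx0 k).2.1

theorem norm_iter_sub_le (k : ℕ) : ‖iter f r x0 k - xs‖ ≤ ‖x0 - xs‖ :=
  (h.iter_mem_region_and_norm_le hx0 k).2.2

theorem isNewtonStep_iter (k : ℕ) : IsNewtonStep (nullSp f xs) ((1 - r) / 64) C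
    (iter f r x0 k - xs) (newtonUpdate f (iter f r x0 k)) :=
  h.isNewtonStep _ (h.iter_mem_region hx0 k)

theorem sigma_iter_succ_le_and_norm_projN_le (k : ℕ) :
    sigma f xs (iter f r x0 (k + 1)) ≤ K * ‖x0 - xs‖ ∧
      ‖projN f xs (iter f r x0 (k + 1) - xs)‖ ≤ 3 / 4 * ‖projN f xs (iter f r x0 k - xs)‖ :=
  (h.mix_mem_region (h.iter_mem_region hx0 _) (h.iter_mem_region hx0 k)
    (h.norm_iter_sub_le hx0 _) (h.norm_iter_sub_le hx0 k) (mem_ball_iff_norm.1 hx0.1)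
    (isSafeguarded_weight h.nonneg k) (iter_succ_sub k)).2.2

theorem regionAt_iter_succ_subset {s : ℝ} (hs : K * ‖x0 - xs‖ ≤ s) (k : ℕ) :
    regionAt f xs (iter f r x0 (k + 1)) ⊆ region f xs ‖x0 - xs‖ s :=
  region_mono (h.norm_iter_sub_le hx0 _)
    ((h.sigma_iter_succ_le_and_norm_projN_le hx0 k).1.trans hs)

theorem mul_norm_sub_le : K * ‖x0 - xs‖ ≤ σ :=
  (mul_le_mul_of_nonneg_left (mem_ball_iff_norm.1 hx0.1).le h.K_pos.le).trans h.K_mul_le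

theorem newtonUpdate_iter_ne_zero (k : ℕ) : newtonUpdate f (iter f r x0 k) ≠ 0 :=
  norm_pos_iff.1 <| (h.isNewtonStep_iter hx0 k).norm_update_pos (by linarith [h.nonneg])

theorem newtonUpdate_iter_succ_ne (k : ℕ) :
    newtonUpdate f (iter f r x0 (k + 1)) ≠ newtonUpdate f (iter f r x0 k) :=
  (h.isNewtonStep_iter hx0 k).update_ne (h.isNewtonStep_iter hx0 (k + 1)) (by linarith [h.nonneg])
    (h.sigma_iter_succ_le_and_norm_projN_le hx0 k).2

theorem tendsto_iter : Tendsto (iter f r x0) atTop (𝓝 xs) := by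
  have hgeom (k : ℕ) : ‖projN f xs (iter f r x0 k - xs)‖ ≤
      (3 / 4) ^ k * ‖projN f xs (x0 - xs)‖ :=
    le_geom (u := fun k => ‖projN f xs (iter f r x0 k - xs)‖) (by norm_num) k fun j _ =>
      (h.sigma_iter_succ_le_and_norm_projN_le hx0 j).2
  have hlim : Tendsto (fun k : ℕ => 2 * ((3 / 4 : ℝ) ^ k * ‖projN f xs (x0 - xs)‖)) atTop
      (𝓝 0) := by
    simpa using ((tendsto_pow_atTop_nhds_zero_of_lt_one (r := (3 / 4 : ℝ)) (by norm_num)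
      (by norm_num)).mul_const ‖projN f xs (x0 - xs)‖).const_mul 2
  refine tendsto_iff_norm_sub_tendsto_zero.2
    (squeeze_zero (fun _ => norm_nonneg _) (fun k => ?_) hlim)
  exact (h.isNewtonStep_iter hx0 k).norm_le.trans (mul_le_mul_of_nonneg_left (hgeom k) two_pos.le)

theorem norm_projR_iter_le (k : ℕ) : ‖projR f xs (iter f r x0 (k + 2) - xs)‖ ≤
    2 * C * max
      (|1 - lamGamma f r (iter f r x0 k) (iter f r x0 (k + 1))| * ‖iter f r x0 (k + 1) - xs‖ ^ 2)
      (|lamGamma f r (iter f r x0 k) (iter f r x0 (k + 1))| * ‖iter f r x0 k - xs‖ ^ 2) := by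
  rw [projR_eq h.isOrtho, iter_succ_sub]
  exact (h.isNewtonStep_iter hx0 k).norm_orthogonal_mix_le_max (h.isNewtonStep_iter hx0 (k + 1))

theorem norm_projN_iter_le (k : ℕ) : ‖projN f xs (iter f r x0 (k + 2) - xs)‖ ≤
    3 / 4 * gain f r (iter f r x0 k) (iter f r x0 (k + 1)) *
      ‖projN f xs (iter f r x0 (k + 1) - xs)‖ := by
  rw [iter_succ_sub]
  exact (h.isNewtonStep_iter hx0 k).norm_starProjection_mix_le (h.isNewtonStep_iter hx0 (k + 1))
    (isSafeguarded_weight h.nonneg (k + 1)) h.nonneg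
    (mul_div_cancel₀ _ (by norm_num : (64 : ℝ) ≠ 0)).le

end IsNewtonBasin

end Iteration

section Basin

variable {f : EuclideanSpace ℝ (Fin n) → EuclideanSpace ℝ (Fin n)}
  {xs φ : EuclideanSpace ℝ (Fin n)} {r m d : ℝ}

theorem fderiv_newtonUpdate {x : EuclideanSpace ℝ (Fin n)} (hx : (fderiv ℝ f x).IsInvertible) :
    fderiv ℝ f x (newtonUpdate f x) = -f x := by
  rw [newtonUpdate, map_neg, ← (hx.inverse_apply_eq).1 rfl]

theorem injective_Dhat_of_finrank_eq_one (hdim : Module.finrank ℝ (nullSp f xs) = 1)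
    (hφ : φ ∈ nullSp f xs) (hφ0 : φ ≠ 0) (hD : Function.Injective (Dhat f xs φ))
    {ψ : EuclideanSpace ℝ (Fin n)} (hψ : ψ ∈ nullSp f xs) (hψ0 : ψ ≠ 0) :
    Function.Injective (Dhat f xs ψ) := by
  obtain ⟨s, hs⟩ := (finrank_eq_one_iff_of_nonzero' (⟨φ, hφ⟩ : nullSp f xs)
    (by simpa using hφ0)).1 hdim ⟨ψ, hψ⟩
  obtain rfl : s • φ = ψ := congrArg Subtype.val hs
  have hDhat (v : nullSp f xs) : Dhat f xs (s • φ) v = s • Dhat f xs φ v := by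
    simp only [Dhat, map_smul, ContinuousLinearMap.comp_apply, smul_apply]
  intro u v huv
  rw [hDhat, hDhat] at huv
  exact hD (smul_right_injective _ (left_ne_zero_of_smul hψ0) huv)

theorem exists_isSingularRoot (hf : ∀ᶠ x in 𝓝 xs, DifferentiableAt ℝ f x)
    (hf' : DifferentiableAt ℝ (fderiv ℝ f) xs) (hroot : f xs = 0)
    (hortho : rangeSp f xs ⟂ nullSp f xs)
    (hD : ∀ φ ∈ nullSp f xs, φ ≠ 0 → Function.Injective (Dhat f xs φ)) :
    ∃ m d, IsSingularRoot (nullSp f xs) f xs m d := by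
  obtain ⟨m, hm, hlow⟩ := exists_mul_norm_starProjection_ker_orthogonal_le (fderiv ℝ f xs)
  obtain ⟨d, hd, hblock⟩ := exists_mul_norm_mul_norm_le_of_nonsingular
    (ContinuousLinearMap.compL ℝ _ _ _ (nullSp f xs).orthogonalProjectionOnto ∘L
      (fderiv ℝ (fderiv ℝ f) xs).bilinearComp (nullSp f xs).subtypeL (nullSp f xs).subtypeL)
    fun u v huv => or_iff_not_imp_left.2 fun hu =>
      hD u u.2 (by simpa using hu) (huv.trans (map_zero _).symm)
  exact ⟨m, d, hroot, hf, hf', fun v hv => hv,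
    fun v => Submodule.isOrtho_iff_le.1 hortho (LinearMap.mem_range_self _ v), hlow,
    fun u v hu hv => hblock ⟨u, hu⟩ ⟨v, hv⟩, hm, hd⟩

theorem IsSingularRoot.exists_isNewtonBasin (h : IsSingularRoot (nullSp f xs) f xs m d)
    (hortho : rangeSp f xs ⟂ nullSp f xs) (hr0 : 0 ≤ r) (hr1 : r < 1) :
    ∃ ρ σ C K, IsNewtonBasin f xs r ρ σ C K := by
  obtain ⟨b, -, hpert⟩ := h.exists_eventually_isSingularPerturbation
  have hinv : ∀ᶠ x in conicNhds (nullSp f xs) xs, (fderiv ℝ f x).IsInvertible :=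
    hpert.mono fun x hx => isInvertible_of_injective hx.injective
  obtain ⟨C, hC, hstep⟩ :=
    h.exists_eventually_isNewtonStep (hinv.mono fun x hx => fderiv_newtonUpdate hx)
  have hr : 0 < 1 - r := sub_pos.2 hr1
  obtain ⟨t, ht, hbasin⟩ := (hasBasis_conicNhds (nullSp f xs) xs).eventually_iff.1
    (hinv.and (hstep ((1 - r) / 64) (by positivity)))
  have hσ : 0 < min t (1 / 3) := by positivity
  have hK : 0 < 24 * C / (1 - r) := by positivity
  have hmem : ∀ x ∈ region f xs (min t (min t (1 / 3) / (24 * C / (1 - r)))) (min t (1 / 3)),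
      _ ∧ _ := fun x hx => hbasin <| (mem_region_iff hortho).1 <|
    region_mono (min_le_left _ _) (min_le_left _ _) hx
  refine ⟨_, _, C, _, hortho, fun x hx => (hmem x hx).1, fun x hx => (hmem x hx).2, hr0, hr1,
    lt_min ht (div_pos hσ hK), hσ, min_le_right _ _, hC, hK, (mul_div_cancel₀ _ hr.ne').ge, ?_⟩
  exact (mul_le_mul_of_nonneg_left (min_le_right _ _) hK.le).trans (mul_div_cancel₀ _ hK.ne').le

end Basin

end NewtonAnderson

open NewtonAnderson in
theorem theorem3p2_general {n : ℕ}
    (f : EuclideanSpace ℝ (Fin n) → EuclideanSpace ℝ (Fin n))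
    (xs : EuclideanSpace ℝ (Fin n)) (hf : ∀ᶠ x in 𝓝 xs, DifferentiableAt ℝ f x)
    (hf' : DifferentiableAt ℝ (fderiv ℝ f) xs) (hroot : f xs = 0)
    (hortho : rangeSp f xs ⟂ nullSp f xs)
    (hD : ∀ φ ∈ nullSp f xs, φ ≠ 0 → Function.Injective (Dhat f xs φ))
    (rhat : ℝ) (hr0 : 0 ≤ rhat) (hr1 : rhat < 1) :
    ∃ σhat > 0, ∃ ρhat > 0, ∃ C > 0, ∃ κ ∈ Set.Ioo (1 / 2 : ℝ) 1, ∃ c > 0,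
      (∀ x ∈ region f xs ρhat σhat, (fderiv ℝ f x).IsInvertible) ∧
      ∀ x0 : EuclideanSpace ℝ (Fin n),
        projN f xs (x0 - xs) ≠ 0 →
        sigma f xs x0 < σhat →
        ‖x0 - xs‖ < ρhat →
        ∀ x : ℕ → EuclideanSpace ℝ (Fin n), x = iter f rhat x0 →
          (∀ k, x k ∈ region f xs ρhat σhat ∧
            (fderiv ℝ f (x k)).IsInvertible ∧
            projN f xs (x k - xs) ≠ 0 ∧
            newtonUpdate f (x k) ≠ 0 ∧
            newtonUpdate f (x (k + 1)) ≠ newtonUpdate f (x k)) ∧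
          (∀ k, regionAt f xs (x (k + 1)) ⊆
            region f xs ‖x0 - xs‖ σhat) ∧
          (‖x0 - xs‖ ≤ c * sigma f xs x0 →
            ∀ k, regionAt f xs (x (k + 1)) ⊆ regionAt f xs x0) ∧
          Tendsto x atTop (𝓝 xs) ∧
          (∀ k, ‖projR f xs (x (k + 2) - xs)‖ ≤
            C * max
              (|1 - lamGamma f rhat (x k) (x (k + 1))| * ‖x (k + 1) - xs‖ ^ 2)
              (|lamGamma f rhat (x k) (x (k + 1))| * ‖x k - xs‖ ^ 2)) ∧
          (∀ k, ‖projN f xs (x (k + 2) - xs)‖ ≤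
            κ * gain f rhat (x k) (x (k + 1)) *
              ‖projN f xs (x (k + 1) - xs)‖) := by
  obtain ⟨m, d, hsing⟩ := exists_isSingularRoot hf hf' hroot hortho hD
  obtain ⟨ρ, σ, C, K, h⟩ := hsing.exists_isNewtonBasin hortho hr0 hr1
  have hC := h.C_pos
  have hK := h.K_pos
  refine ⟨σ, h.σ_pos, ρ, h.ρ_pos, 2 * C, by positivity, 3 / 4, by norm_num, 1 / K, by positivity,
    h.isInvertible, ?_⟩
  rintro x0 hN hσ hρ _ rfl
  have hx0 : x0 ∈ region f xs ρ σ :=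
    ⟨mem_ball_iff_norm.2 hρ, (div_lt_iff₀ (norm_pos_iff.2 hN)).1 hσ⟩
  refine ⟨fun k => ⟨h.iter_mem_region hx0 k, h.isInvertible _ (h.iter_mem_region hx0 k),
      norm_pos_iff.1 (h.isNewtonStep_iter hx0 k).pos, h.newtonUpdate_iter_ne_zero hx0 k,
      h.newtonUpdate_iter_succ_ne hx0 k⟩,
    h.regionAt_iter_succ_subset hx0 (h.mul_norm_sub_le hx0),
    fun hc => h.regionAt_iter_succ_subset hx0 ?_,
    h.tendsto_iter hx0, h.norm_projR_iter_le hx0, h.norm_projN_iter_le hx0⟩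
  rwa [one_div_mul_eq_div, le_div_iff₀' hK] at hc

theorem theorem3p2 {n : ℕ}
    (f : EuclideanSpace ℝ (Fin n) → EuclideanSpace ℝ (Fin n)) (hf : ContDiff ℝ 3 f)
    (xs : EuclideanSpace ℝ (Fin n)) (hroot : f xs = 0)
    (hdim : Module.finrank ℝ (NewtonAnderson.nullSp f xs) = 1)
    (hortho : NewtonAnderson.rangeSp f xs ⟂ NewtonAnderson.nullSp f xs)
    (φ : EuclideanSpace ℝ (Fin n)) (hφ : φ ∈ NewtonAnderson.nullSp f xs) (hφ0 : φ ≠ 0)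
    (hD : Function.Bijective (NewtonAnderson.Dhat f xs φ))
    (rhat : ℝ) (hr0 : 0 < rhat) (hr1 : rhat < 1) :
    ∃ σhat > 0, ∃ ρhat > 0, ∃ C > 0, ∃ κ ∈ Set.Ioo (1 / 2 : ℝ) 1, ∃ c > 0,
      (∀ x ∈ NewtonAnderson.region f xs ρhat σhat, (fderiv ℝ f x).IsInvertible) ∧
      ∀ x0 : EuclideanSpace ℝ (Fin n),
        NewtonAnderson.projN f xs (x0 - xs) ≠ 0 →
        NewtonAnderson.sigma f xs x0 < σhat →
        ‖x0 - xs‖ < ρhat →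
        ∀ x : ℕ → EuclideanSpace ℝ (Fin n), x = NewtonAnderson.iter f rhat x0 →
          -- the iteration is well defined: derivatives are invertible, no denominator vanishes
          (∀ k, x k ∈ NewtonAnderson.region f xs ρhat σhat ∧
            (fderiv ℝ f (x k)).IsInvertible ∧
            NewtonAnderson.projN f xs (x k - xs) ≠ 0 ∧
            NewtonAnderson.newtonUpdate f (x k) ≠ 0 ∧
            NewtonAnderson.newtonUpdate f (x (k + 1)) ≠ NewtonAnderson.newtonUpdate f (x k)) ∧
          -- the sets `W_{k+1}` stay in the ball of radius `‖e_0‖` and in the cone of aperture `σhat`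
          (∀ k, NewtonAnderson.regionAt f xs (x (k + 1)) ⊆
            NewtonAnderson.region f xs ‖x0 - xs‖ σhat) ∧
          -- `W_{k+1} ⊆ W_0` as soon as `‖e_0‖` is small relative to `σ_0`
          (‖x0 - xs‖ ≤ c * NewtonAnderson.sigma f xs x0 →
            ∀ k, NewtonAnderson.regionAt f xs (x (k + 1)) ⊆ NewtonAnderson.regionAt f xs x0) ∧
          Tendsto x atTop (𝓝 xs) ∧
          -- the two estimates; the step from `x_{k+1}` (and `x_k`) to `x_{k+2}`, for all `k ≥ 0`
          (∀ k, ‖NewtonAnderson.projR f xs (x (k + 2) - xs)‖ ≤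
            C * max
              (|1 - NewtonAnderson.lamGamma f rhat (x k) (x (k + 1))| * ‖x (k + 1) - xs‖ ^ 2)
              (|NewtonAnderson.lamGamma f rhat (x k) (x (k + 1))| * ‖x k - xs‖ ^ 2)) ∧
          (∀ k, ‖NewtonAnderson.projN f xs (x (k + 2) - xs)‖ ≤
            κ * NewtonAnderson.gain f rhat (x k) (x (k + 1)) *
              ‖NewtonAnderson.projN f xs (x (k + 1) - xs)‖) :=
  theorem3p2_general f xs (.of_forall (hf.differentiable (by norm_num)))
    ((hf.fderiv_right (m := 1) (by norm_num)).differentiable one_ne_zero xs) hroot hortho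
    (fun _ => NewtonAnderson.injective_Dhat_of_finrank_eq_one hdim hφ hφ0 hD.injective) rhat hr0.le
    hr1
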